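/- Let $\mathbb K\in\{\mathbb R,\mathbb C\}$ and $r\ge 2$. In the group ring $\mathbb K[S_{r+1}]$ put $$e_a=\frac1{r!}\sum_{p\in S_{r+1},\,p(r+1)=r+1}\operatorname{sign}(p)\,p,\qquad f_a=\frac1{(r+1)!}\sum_{p\in S_{r+1}}\operatorname{sign}(p)\,p,\qquad h_a=e_a-f_a .$$ (The left ideal $\mathbb K[S_{r+1}]\cdot e_a$ defines the symmetry class of the torsion-free covariant derivatives $\nabla A$ of alternating covariant tensor fields $A$ of order $r$.) For a Young tableau $t$ with $r+1$ boxes, filled bijectively with $1,\dots,r+1$, let $y_t=\sum_{p\in H_t}\sum_{q\in V_t}\operatorname{sign}(q)\,p\cdot q$ be its Young symmetrizer, where $H_t$ and $V_t$ are the groups of permutations that keep every number in its row, respectively in its column. The Young symmetrizer idempotent of $t$ is the idempotent of the form $e_t=\mu_t y_t$ with $\mu_t\in\mathbb K\setminus\{0\}$. Tableaux of the same shape are compared lexicographically: $t_2$ is greater than $t_1$ if, reading rows from left to right and from top to bottom, $t_2$ has the greater entry at the first box in which they differ. For a left ideal $\mathfrak l$ of $\mathbb K[S_{r+1}]$ and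 a partition $\lambda\vdash r+1$, the $[\lambda]$-part of $\mathfrak l$ is the sum of all left ideals contained in $\mathfrak l$ that are isomorphic, as left modules, to $\mathbb K[S_{r+1}]\cdot y_s$ for some tableau $s$ of shape $\lambda$. Theorem. Let $t$ be the tableau of shape $(2,1^{r-1})\vdash r+1$ with first row $1,\,r+1$ and first column $1,2,\dots,r$. Then: 1. $t$ is standard and lexicographically greater than every other standard tableau of shape $(2,1^{r-1})$; for every standard tableau $s$ of this shape the idempotent $e_s$ exists and is unique; and $h_a$ is an idempotent. 2. $h_a\cdot e_t=h_a$. Moreover $\mathbb K[S_{r+1}]\cdot e_t=\mathbb K[S_{r+1}]\cdot h_a$, and this left ideal is the $[2,1^{r-1}]$-part of $\mathbb K[S_{r+1}]\cdot e_a$; that is, $e_t$ generates the $[2,1^{r-1}]$-part of $\nabla A$. 3. $h_a\cdot e_{t'}=0$ for every standard tableau $t'\ne t$ of shape $(2,1^{r-1})$. -/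

import Mathlib

/-- A Young tableau of shape `μ` with `n` boxes: a bijection of the boxes of `μ` onto the label set.
The labels `1, …, n` are represented by the elements `0, …, n - 1` of `Fin n`. A box is a pair
`(i, j)` of its row index and its column index, both counted from `0`. -/
abbrev YoungTableau (μ : YoungDiagram) (n : ℕ) : Type := {c : ℕ × ℕ // c ∈ μ.cells} ≃ Fin n

namespace YoungTableau

variable {μ : YoungDiagram} {n : ℕ}

/-- The row in which the label `k` stands. -/
def rowOf (t : YoungTableau μ n) (k : Fin n) : ℕ := (t.symm k).1.1

/-- The column in which the label `k` stands. -/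
def colOf (t : YoungTableau μ n) (k : Fin n) : ℕ := (t.symm k).1.2

/-- The labels increase along every row from left to right and down every column. -/
def IsStandard (t : YoungTableau μ n) : Prop :=
  (∀ c d : {c : ℕ × ℕ // c ∈ μ.cells}, c.1.1 = d.1.1 → c.1.2 < d.1.2 → t c < t d) ∧
  (∀ c d : {c : ℕ × ℕ // c ∈ μ.cells}, c.1.2 = d.1.2 → c.1.1 < d.1.1 → t c < t d)

/-- `t₁` is lexicographically smaller than `t₂`: reading both tableaux row by row, from left to
right and from top to bottom, at the first box where they differ `t₂` has the greater label. -/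
def LexLT (t₁ t₂ : YoungTableau μ n) : Prop :=
  ∃ c : {c : ℕ × ℕ // c ∈ μ.cells}, t₁ c < t₂ c ∧
    ∀ d : {c : ℕ × ℕ // c ∈ μ.cells},
      (d.1.1 < c.1.1 ∨ (d.1.1 = c.1.1 ∧ d.1.2 < c.1.2)) → t₁ d = t₂ d

/-- The group of horizontal permutations: every label stays in its row. -/
def rowGroup (t : YoungTableau μ n) : Subgroup (Equiv.Perm (Fin n)) where
  carrier := {p | ∀ k, t.rowOf (p k) = t.rowOf k}
  mul_mem' := fun {p q} hp hq k => by
    rw [Equiv.Perm.mul_apply, hp (q k), hq k]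
  one_mem' := fun _ => rfl
  inv_mem' := fun {p} hp k => by
    simpa using (hp (p⁻¹ k)).symm

/-- The group of vertical permutations: every label stays in its column. -/
def colGroup (t : YoungTableau μ n) : Subgroup (Equiv.Perm (Fin n)) where
  carrier := {q | ∀ k, t.colOf (q k) = t.colOf k}
  mul_mem' := fun {p q} hp hq k => by
    rw [Equiv.Perm.mul_apply, hp (q k), hq k]
  one_mem' := fun _ => rfl
  inv_mem' := fun {p} hp k => by
    simpa using (hp (p⁻¹ k)).symm

open scoped Classical in
/-- The Young symmetrizer `y_t = ∑_{p horizontal} ∑_{q vertical} sign(q) p q` in the group ring. -/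
noncomputable def youngSymmetrizer (K : Type*) [Field K] (t : YoungTableau μ n) :
    MonoidAlgebra K (Equiv.Perm (Fin n)) :=
  ∑ p : Equiv.Perm (Fin n) with p ∈ t.rowGroup,
    ∑ q : Equiv.Perm (Fin n) with q ∈ t.colGroup,
      ((Equiv.Perm.sign q : ℤ) : K) • MonoidAlgebra.of K (Equiv.Perm (Fin n)) (p * q)

/-- `e` is the Young symmetrizer idempotent of `t`: an idempotent that is a non-zero scalar
multiple of the Young symmetrizer of `t`. -/
def IsYoungIdempotent (K : Type*) [Field K] (t : YoungTableau μ n)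
    (e : MonoidAlgebra K (Equiv.Perm (Fin n))) : Prop :=
  IsIdempotentElem e ∧ ∃ m : K, m ≠ 0 ∧ e = m • t.youngSymmetrizer K

end YoungTableau

/-- The part of type `[μ]` of a left ideal `I` of the group ring of `S_n`: the sum of all left
ideals contained in `I` that are isomorphic, as left modules, to a left ideal generated by a Young
symmetrizer of shape `μ`. (For a non-commutative ring, `Ideal` means left ideal.) -/
noncomputable def youngPart (K : Type*) [Field K] {n : ℕ} (μ : YoungDiagram)
    (I : Ideal (MonoidAlgebra K (Equiv.Perm (Fin n)))) :
    Ideal (MonoidAlgebra K (Equiv.Perm (Fin n))) :=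
  sSup {N : Ideal (MonoidAlgebra K (Equiv.Perm (Fin n))) | N ≤ I ∧ ∃ t : YoungTableau μ n,
    Nonempty (N ≃ₗ[MonoidAlgebra K (Equiv.Perm (Fin n))] Ideal.span {t.youngSymmetrizer K})}

/-- `e_a = (1 / r!) ∑ sign(p) p`, over the permutations in `S_{r+1}` that fix `r + 1`. -/
noncomputable def idemEA (K : Type*) [Field K] (r : ℕ) :
    MonoidAlgebra K (Equiv.Perm (Fin (r + 1))) :=
  (1 / (r.factorial : K)) • ∑ p : Equiv.Perm (Fin (r + 1)) with p (Fin.last r) = Fin.last r,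
    ((Equiv.Perm.sign p : ℤ) : K) • MonoidAlgebra.of K (Equiv.Perm (Fin (r + 1))) p

/-- `f_a = (1 / (r+1)!) ∑ sign(p) p`, over all permutations in `S_{r+1}`. -/
noncomputable def idemFA (K : Type*) [Field K] (r : ℕ) :
    MonoidAlgebra K (Equiv.Perm (Fin (r + 1))) :=
  (1 / ((r + 1).factorial : K)) • ∑ p : Equiv.Perm (Fin (r + 1)),
    ((Equiv.Perm.sign p : ℤ) : K) • MonoidAlgebra.of K (Equiv.Perm (Fin (r + 1))) p

/-- `h_a`, defined by the decomposition `e_a = f_a + h_a`. -/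
noncomputable def idemHA (K : Type*) [Field K] (r : ℕ) :
    MonoidAlgebra K (Equiv.Perm (Fin (r + 1))) :=
  idemEA K r - idemFA K r

theorem twoOnes_sortedGE (r : ℕ) : (2 :: List.replicate (r - 1) 1).SortedGE := by
  rw [List.sortedGE_iff_pairwise, List.pairwise_cons]
  refine ⟨fun a ha => ?_, ?_⟩
  · rw [List.eq_of_mem_replicate ha]; norm_num
  · rw [List.pairwise_replicate]; right; exact le_refl _

/-- The Young frame `(2, 1^{r-1})`: row lengths `2, 1, …, 1` with `r - 1` ones (used for `1 ≤ r`). -/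
def twoOnesShape (r : ℕ) : YoungDiagram :=
  YoungDiagram.ofRowLens (2 :: List.replicate (r - 1) 1) (twoOnes_sortedGE r)

theorem mem_twoOnesShape {r : ℕ} (hr : 1 ≤ r) (c : ℕ × ℕ) :
    c ∈ (twoOnesShape r).cells ↔ c = (0, 1) ∨ (c.1 < r ∧ c.2 = 0) := by
  obtain ⟨i, j⟩ := c
  rw [YoungDiagram.mem_cells, twoOnesShape, YoungDiagram.mem_ofRowLens]
  rcases i with _ | i
  · simp; omega
  · simp; omega

/-- The tableau of shape `(2, 1^{r-1})` with first row `1, r + 1` and first column `1, 2, …, r`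
(in terms of `Fin (r + 1)`: first row `0, r` and first column `0, 1, …, r - 1`). -/
def topTableau (r : ℕ) (hr : 2 ≤ r) : YoungTableau (twoOnesShape r) (r + 1) where
  toFun c := if h : c.1.2 = 0 then
      ⟨c.1.1, by have := (mem_twoOnesShape (by omega) c.1).1 c.2; grind⟩
    else Fin.last r
  invFun k := if h : (k : ℕ) < r then
      ⟨((k : ℕ), 0), (mem_twoOnesShape (by omega) _).2 (Or.inr ⟨h, rfl⟩)⟩
    else ⟨(0, 1), (mem_twoOnesShape (by omega) _).2 (Or.inl rfl)⟩
  left_inv := by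
    rintro ⟨⟨i, j⟩, hc⟩
    have h := (mem_twoOnesShape (by omega) _).1 hc
    simp only [Prod.mk.injEq] at h
    rcases h with ⟨rfl, rfl⟩ | ⟨h, rfl⟩
    · simp
    · simp [h]
  right_inv := by
    intro k
    by_cases h : (k : ℕ) < r
    · simp [h]
    · simp only [h, dite_false]
      apply Fin.ext
      simp
      omega

/-!
Three idempotents of the group ring of `S_{r+1}` are in play: `e = e_a`, the alternating idempotent
of the stabilizer of the last point, `f = f_a`, that of the whole group, and `h = h_a = e - f`.
Everything rests on the product `e τ e`, for a transposition `τ` moving the last point. Splitting `f`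
into the cosets of the stabilizer, and using that these transpositions are conjugate under the
stabilizer, one gets `r • e τ e = e - (r + 1) • f`
(`Equiv.Perm.smul_altIdem_mul_swap_mul_altIdem`).

A tableau of shape `(2, 1^{r-1})` with first row `a, k` has row group `{1, (a k)}` and its column
group is the stabilizer of `k`. Hence its Young symmetrizer is a nonzero multiple of `(1 + (a k)) e_k`,
with `e_k` the alternating idempotent of the stabilizer of `k`. Let `g` be `r / (r + 1)` times this
element (`Equiv.Perm.hookIdem`). The identity above gives `e_k g = e_k - f`; since moreover `g e_k = g`
and `g f = 0`, the element `g` is idempotent, and it is the only nonzero idempotent multiple of the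
symmetrizer.

For `k` the last point this reads `h g = h` and `g h = g`, so `g` and `h` generate the same left ideal.
If `a` and `k` both differ from the last point, then `(a k)` acts on `h` from the right by `-1`, so
`h (1 + (a k)) = 0` and `h g = 0`. A standard tableau has its least label in the corner, and only one
standard tableau has the greatest label in the arm, so these two cases are the two cases of the
theorem, and the comparison of the labels in the arm also gives the lexicographic order.

Finally, `g x f = 0` for every `x` in the group ring, because `x f` is a multiple of `f`. So
every left ideal isomorphic to the one generated by a symmetrizer of this shape is annihilated
by `f` from the right (`mul_idemFA_eq_zero_of_linearEquiv`), and if it lies in the left ideal of `e`,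
then it lies in the left ideal of `h`.
-/

/-! ### Alternating idempotents -/

namespace Equiv.Perm

open scoped Classical in
/-- The alternating idempotent `(1 / |H|) ∑_{p ∈ H} sign(p) p` of a subgroup `H` of the permutations
of a finite type. It is idempotent when `|H|` is invertible in `K`. -/
noncomputable def altIdem (K : Type*) [Field K] {α : Type*} [Fintype α] [DecidableEq α]
    (H : Subgroup (Perm α)) : MonoidAlgebra K (Perm α) :=
  (Nat.card H : K)⁻¹ • ∑ p : Perm α with p ∈ H, ((sign p : ℤ) : K) • MonoidAlgebra.of K (Perm α) p

variable {K : Type*} [Field K] {α : Type*} [Fintype α] [DecidableEq α]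

theorem sign_cast_mul_self (g : Perm α) : ((sign g : ℤ) : K) * ((sign g : ℤ) : K) = 1 := by
  rw [← Int.cast_mul, ← Units.val_mul, Int.units_mul_self]; simp

theorem of_mul_altIdem {H : Subgroup (Perm α)} {g : Perm α} (hg : g ∈ H) :
    MonoidAlgebra.of K _ g * altIdem K H = ((sign g : ℤ) : K) • altIdem K H := by
  classical
  unfold altIdem
  rw [mul_smul_comm, smul_comm]
  congr 1
  rw [Finset.mul_sum, Finset.smul_sum]
  refine Finset.sum_bijective (g * ·) (Group.mulLeft_bijective g) (fun p => ?_) fun p _ => ?_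
  · simp [H.mul_mem_cancel_left hg]
  · rw [mul_smul_comm, ← map_mul, sign_mul, smul_smul, Units.val_mul, Int.cast_mul, ← mul_assoc,
      sign_cast_mul_self, one_mul]

theorem altIdem_mul_of {H : Subgroup (Perm α)} {g : Perm α} (hg : g ∈ H) :
    altIdem K H * MonoidAlgebra.of K _ g = ((sign g : ℤ) : K) • altIdem K H := by
  classical
  unfold altIdem
  rw [smul_mul_assoc, smul_comm]
  congr 1
  rw [Finset.sum_mul, Finset.smul_sum]
  refine Finset.sum_bijective (· * g) (Group.mulRight_bijective g) (fun p => ?_) fun p _ => ?_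
  · simp [H.mul_mem_cancel_right hg]
  · rw [smul_mul_assoc, ← map_mul, sign_mul, smul_smul, Units.val_mul, Int.cast_mul, mul_left_comm,
      sign_cast_mul_self, mul_one]

theorem altIdem_mul_altIdem_of_le [CharZero K] {H G : Subgroup (Perm α)} (h : H ≤ G) :
    altIdem K H * altIdem K G = altIdem K G := by
  classical
  conv_lhs => enter [1]; unfold altIdem
  rw [smul_mul_assoc, Finset.sum_mul, Finset.sum_congr rfl (g := fun _ => altIdem K G)]
  · rw [Finset.sum_const, ← Nat.cast_smul_eq_nsmul K, smul_smul, ← Fintype.card_subtype,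
      ← Nat.card_eq_fintype_card, inv_mul_cancel₀, one_smul]
    exact Nat.cast_ne_zero.2 Nat.card_pos.ne'
  · intro p hp
    rw [smul_mul_assoc, of_mul_altIdem (h (by simpa using hp)), smul_smul, sign_cast_mul_self,
      one_smul]

theorem altIdem_mul_altIdem_of_ge [CharZero K] {H G : Subgroup (Perm α)} (h : H ≤ G) :
    altIdem K G * altIdem K H = altIdem K G := by
  classical
  conv_lhs => enter [2]; unfold altIdem
  rw [mul_smul_comm, Finset.mul_sum, Finset.sum_congr rfl (g := fun _ => altIdem K G)]
  · rw [Finset.sum_const, ← Nat.cast_smul_eq_nsmul K, smul_smul, ← Fintype.card_subtype,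
      ← Nat.card_eq_fintype_card, inv_mul_cancel₀, one_smul]
    exact Nat.cast_ne_zero.2 Nat.card_pos.ne'
  · intro p hp
    rw [mul_smul_comm, altIdem_mul_of (h (by simpa using hp)), smul_smul, sign_cast_mul_self,
      one_smul]

/-- The alternating idempotent of the full symmetric group spans a one-dimensional left ideal. -/
theorem exists_mul_altIdem_top_eq_smul (x : MonoidAlgebra K (Perm α)) :
    ∃ c : K, x * altIdem K ⊤ = c • altIdem K ⊤ := by
  induction x using MonoidAlgebra.induction_on with
  | of g => exact ⟨_, of_mul_altIdem (Subgroup.mem_top g)⟩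
  | add x y hx hy =>
    obtain ⟨a, ha⟩ := hx
    obtain ⟨b, hb⟩ := hy
    exact ⟨a + b, by rw [add_mul, ha, hb, add_smul]⟩
  | smul c x hx =>
    obtain ⟨a, ha⟩ := hx
    exact ⟨c * a, by rw [smul_mul_assoc, ha, smul_smul]⟩

theorem coeff_altIdem (H : Subgroup (Perm α)) (g : Perm α) [Decidable (g ∈ H)] :
    (altIdem K H).coeff g = if g ∈ H then (Nat.card H : K)⁻¹ * ((sign g : ℤ) : K) else 0 := by
  classical
  unfold altIdem
  simp [MonoidAlgebra.coeff_sum, Finsupp.single_apply]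

theorem card_stabilizer_mul_card (k : α) :
    Fintype.card α * Nat.card (MulAction.stabilizer (Perm α) k) = (Fintype.card α).factorial := by
  rw [← Fintype.card_perm, ← Nat.card_eq_fintype_card (α := Perm α),
    ← (MulAction.stabilizer (Perm α) k).index_mul_card, MulAction.index_stabilizer_of_transitive,
    Nat.card_eq_fintype_card (α := α)]

/-- Splitting the symmetric group into the left cosets `(i k) S` of the stabilizer `S` of `k`. -/
theorem card_smul_altIdem_top [CharZero K] (k : α) :
    (Fintype.card α : K) • altIdem K (⊤ : Subgroup (Perm α)) =
      altIdem K (MulAction.stabilizer (Perm α) k) -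
        ∑ i : α with i ≠ k,
          MonoidAlgebra.of K _ (swap i k) * altIdem K (MulAction.stabilizer (Perm α) k) := by
  classical
  have hcα : (Fintype.card α : K) ≠ 0 :=
    Nat.cast_ne_zero.2 (Fintype.card_pos_iff.2 ⟨k⟩).ne'
  have hc : (Fintype.card α : K) * (Nat.card (⊤ : Subgroup (Perm α)) : K)⁻¹ =
      (Nat.card (MulAction.stabilizer (Perm α) k) : K)⁻¹ := by
    rw [Subgroup.card_top, Nat.card_eq_fintype_card, Fintype.card_perm, ← card_stabilizer_mul_card k,
      Nat.cast_mul, mul_inv, mul_inv_cancel_left₀ hcα]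
  have hcoset (i : α) : ∑ p : Perm α with p k = i, ((sign p : ℤ) : K) • MonoidAlgebra.of K _ p =
      ((sign (swap i k) : ℤ) : K) • (MonoidAlgebra.of K _ (swap i k) *
        ∑ p : Perm α with p ∈ MulAction.stabilizer (Perm α) k,
          ((sign p : ℤ) : K) • MonoidAlgebra.of K (Perm α) p) := by
    rw [Finset.mul_sum, Finset.smul_sum]
    symm
    refine Finset.sum_bijective (swap i k * ·) (Group.mulLeft_bijective _) (fun p => ?_) fun p _ => ?_
    · simp [MulAction.mem_stabilizer_iff, swap_apply_eq_iff]
    · rw [mul_smul_comm, ← map_mul, sign_mul, smul_smul, Units.val_mul, Int.cast_mul]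
  have hsum : ∑ p : Perm α, ((sign p : ℤ) : K) • MonoidAlgebra.of K _ p =
      ∑ i : α, ((sign (swap i k) : ℤ) : K) • (MonoidAlgebra.of K _ (swap i k) *
        ∑ p : Perm α with p ∈ MulAction.stabilizer (Perm α) k,
          ((sign p : ℤ) : K) • MonoidAlgebra.of K (Perm α) p) := by
    rw [← Finset.sum_fiberwise Finset.univ (fun p : Perm α => p k)]
    exact Finset.sum_congr rfl fun i _ => hcoset i
  unfold altIdem
  rw [smul_smul, hc]
  simp only [mul_smul_comm]
  rw [← Finset.smul_sum, ← smul_sub]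
  congr 1
  rw [show ({p | p ∈ (⊤ : Subgroup (Perm α))} : Finset (Perm α)) = Finset.univ by ext; simp, hsum,
    ← Finset.sum_filter_add_sum_filter_not _ (fun i => i = k), Finset.filter_eq' _ k,
    if_pos (Finset.mem_univ k), Finset.sum_singleton, swap_self, sub_eq_add_neg,
    ← Finset.sum_neg_distrib]
  congr 1
  · rw [← one_def, sign_one, map_one, Units.val_one, Int.cast_one, one_smul, one_mul]
    congr!
  · refine Finset.sum_congr rfl fun i hi => ?_
    rw [sign_swap (by simpa using hi)]
    simp

/-- The product `e τ e`, for `e` the alternating idempotent of the stabilizer of `k` and `τ` a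
transposition moving `k`, does not depend on `τ`, since the transpositions moving `k` are conjugate
under the stabilizer. -/
theorem altIdem_mul_swap_mul_altIdem_congr {k a b : α} (ha : a ≠ k) (hb : b ≠ k) :
    altIdem K (MulAction.stabilizer (Perm α) k) * (MonoidAlgebra.of K _ (swap a k) *
      altIdem K (MulAction.stabilizer (Perm α) k)) =
    altIdem K (MulAction.stabilizer (Perm α) k) * (MonoidAlgebra.of K _ (swap b k) *
      altIdem K (MulAction.stabilizer (Perm α) k)) := by
  have hσ : swap a b ∈ MulAction.stabilizer (Perm α) k := by
    rw [MulAction.mem_stabilizer_iff, Perm.smul_def, swap_apply_of_ne_of_ne ha.symm hb.symm]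
  have hconj : swap a k = swap a b * (swap b k * swap a b) := by
    have := mul_swap_eq_swap_mul (swap a b) b k
    rw [swap_apply_right, swap_apply_of_ne_of_ne ha.symm hb.symm] at this
    rw [← mul_assoc, this, mul_assoc, swap_mul_self, mul_one]
  rw [hconj, map_mul, map_mul, mul_assoc, mul_assoc, of_mul_altIdem hσ, mul_smul_comm,
    mul_smul_comm, mul_smul_comm, ← mul_assoc, altIdem_mul_of hσ, smul_mul_assoc, smul_smul,
    sign_cast_mul_self, one_smul]

/-- The identity `(n - 1) e τ e = e - n f`, where `n` is the number of points, `e` is the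
alternating idempotent of the stabilizer of `k`, `f` that of the full symmetric group, and `τ` is a
transposition moving `k`. -/
theorem smul_altIdem_mul_swap_mul_altIdem [CharZero K] {k a : α} (ha : a ≠ k) :
    ((Fintype.card α : K) - 1) • (altIdem K (MulAction.stabilizer (Perm α) k) *
      (MonoidAlgebra.of K _ (swap a k) * altIdem K (MulAction.stabilizer (Perm α) k))) =
    altIdem K (MulAction.stabilizer (Perm α) k) -
      (Fintype.card α : K) • altIdem K (⊤ : Subgroup (Perm α)) := by
  set e := altIdem K (MulAction.stabilizer (Perm α) k) with he
  have h := congrArg (e * ·) (card_smul_altIdem_top (K := K) k)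
  simp only [← he] at h
  rw [mul_smul_comm, altIdem_mul_altIdem_of_le le_top, mul_sub, altIdem_mul_altIdem_of_le le_rfl,
    Finset.mul_sum, Finset.sum_congr rfl (g := fun _ => e * (MonoidAlgebra.of K _ (swap a k) * e)),
    Finset.sum_const, Finset.filter_ne', Finset.card_erase_of_mem (Finset.mem_univ k),
    Finset.card_univ, ← Nat.cast_smul_eq_nsmul K,
    Nat.cast_sub (Fintype.card_pos_iff.2 ⟨k⟩), Nat.cast_one] at h
  · rw [h, sub_sub_cancel]
  · intro i hi
    exact altIdem_mul_swap_mul_altIdem_congr (by simpa using hi) ha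

end Equiv.Perm

/-! ### The idempotent of a hook with one box in its arm -/

namespace Equiv.Perm

/-- The element `((n - 1) / n) (1 + (a k)) e` of the group ring, where `n` is the number of points
and `e` is the alternating idempotent of the stabilizer of `k`. For `a ≠ k` it is the Young
symmetrizer idempotent of a tableau of shape `(2, 1^{n-2})` with first row `a, k`. -/
noncomputable def hookIdem (K : Type*) [Field K] {α : Type*} [Fintype α] [DecidableEq α]
    (k a : α) : MonoidAlgebra K (Perm α) :=
  (((Fintype.card α : K) - 1) / Fintype.card α) • ((1 + MonoidAlgebra.of K _ (swap a k)) *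
    altIdem K (MulAction.stabilizer (Perm α) k))

section

variable {K : Type*} [Field K] [CharZero K] {α : Type*} [Fintype α] {k a : α}

theorem card_sub_one_ne_zero_of_ne (ha : a ≠ k) : (Fintype.card α : K) - 1 ≠ 0 := by
  have : 1 < Fintype.card α := Fintype.one_lt_card_iff.2 ⟨a, k, ha⟩
  exact sub_ne_zero.2 (Nat.cast_ne_one.2 this.ne')

theorem card_ne_zero_of_point (k : α) : (Fintype.card α : K) ≠ 0 :=
  Nat.cast_ne_zero.2 (Fintype.card_pos_iff.2 ⟨k⟩).ne'

end

variable {K : Type*} [Field K] {α : Type*} [Fintype α] [DecidableEq α] {k a : α}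

theorem altIdem_top_mul_hookIdem (ha : a ≠ k) : altIdem K ⊤ * hookIdem K k a = 0 := by
  rw [hookIdem, mul_smul_comm, ← mul_assoc, mul_add, mul_one,
    altIdem_mul_of (Subgroup.mem_top _), sign_swap ha]
  simp

variable [CharZero K]

theorem hookIdem_mul_altIdem_top (ha : a ≠ k) : hookIdem K k a * altIdem K ⊤ = 0 := by
  rw [hookIdem, smul_mul_assoc, mul_assoc, altIdem_mul_altIdem_of_le le_top, add_mul, one_mul,
    of_mul_altIdem (Subgroup.mem_top _), sign_swap ha]
  simp

theorem hookIdem_mul_mul_altIdem_top (ha : a ≠ k) (x : MonoidAlgebra K (Perm α)) :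
    hookIdem K k a * (x * altIdem K ⊤) = 0 := by
  obtain ⟨c, hc⟩ := exists_mul_altIdem_top_eq_smul x
  rw [hc, mul_smul_comm, hookIdem_mul_altIdem_top ha, smul_zero]

theorem hookIdem_mul_altIdem_stabilizer :
    hookIdem K k a * altIdem K (MulAction.stabilizer (Perm α) k) = hookIdem K k a := by
  rw [hookIdem, smul_mul_assoc, mul_assoc, altIdem_mul_altIdem_of_le le_rfl]

theorem altIdem_stabilizer_mul_hookIdem (ha : a ≠ k) :
    altIdem K (MulAction.stabilizer (Perm α) k) * hookIdem K k a =
      altIdem K (MulAction.stabilizer (Perm α) k) - altIdem K ⊤ := by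
  have hn := card_ne_zero_of_point (K := K) k
  rw [hookIdem, mul_smul_comm, add_mul, mul_add, one_mul, altIdem_mul_altIdem_of_le le_rfl,
    div_eq_inv_mul, mul_smul, smul_add, smul_altIdem_mul_swap_mul_altIdem ha, sub_smul, one_smul,
    sub_add_sub_cancel, ← smul_sub, inv_smul_smul₀ hn]

theorem isIdempotentElem_hookIdem (ha : a ≠ k) : IsIdempotentElem (hookIdem K k a) := by
  rw [IsIdempotentElem]
  nth_rewrite 1 [← hookIdem_mul_altIdem_stabilizer]
  rw [mul_assoc, altIdem_stabilizer_mul_hookIdem ha, mul_sub, hookIdem_mul_altIdem_stabilizer,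
    hookIdem_mul_altIdem_top ha, sub_zero]

theorem hookIdem_ne_zero (ha : a ≠ k) : hookIdem K k a ≠ 0 := by
  classical
  intro h
  have h1 : altIdem K (MulAction.stabilizer (Perm α) k) - altIdem K ⊤ = 0 := by
    rw [← altIdem_stabilizer_mul_hookIdem ha, h, mul_zero]
  -- the transposition `(a k)` occurs in the full alternating idempotent but not in that of the
  -- stabilizer
  have h2 := congrArg (fun x => MonoidAlgebra.coeff x (swap a k)) (sub_eq_zero.1 h1)
  simp only [coeff_altIdem, MulAction.mem_stabilizer_iff, Perm.smul_def, swap_apply_right,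
    if_neg ha, if_pos (Subgroup.mem_top _), sign_swap ha] at h2
  simp at h2

end Equiv.Perm

theorem twoOnesShape_corner_mem {r : ℕ} (hr : 1 ≤ r) : (0, 0) ∈ (twoOnesShape r).cells :=
  (mem_twoOnesShape hr _).2 (Or.inr ⟨hr, rfl⟩)

theorem twoOnesShape_arm_mem {r : ℕ} (hr : 1 ≤ r) : (0, 1) ∈ (twoOnesShape r).cells :=
  (mem_twoOnesShape hr _).2 (Or.inl rfl)

namespace YoungTableau

open Equiv Equiv.Perm

/-! ### Tableaux of shape `(2, 1^{r-1})` -/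

section

variable {r : ℕ} (hr : 1 ≤ r) (t : YoungTableau (twoOnesShape r) (r + 1))

/-- The label of the first box of the first row. -/
def cornerLabel : Fin (r + 1) := t ⟨(0, 0), twoOnesShape_corner_mem hr⟩

/-- The label of the second box of the first row. -/
def armLabel : Fin (r + 1) := t ⟨(0, 1), twoOnesShape_arm_mem hr⟩

theorem cornerLabel_ne_armLabel : t.cornerLabel hr ≠ t.armLabel hr := by
  simp [cornerLabel, armLabel]

theorem colOf_eq (x : Fin (r + 1)) : t.colOf x = if x = t.armLabel hr then 1 else 0 := by
  obtain ⟨⟨⟨i, j⟩, hc⟩, rfl⟩ := t.surjective x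
  have h := (mem_twoOnesShape hr _).1 hc
  simp only [colOf, armLabel, symm_apply_apply, EmbeddingLike.apply_eq_iff_eq, Subtype.mk.injEq,
    Prod.mk.injEq] at h ⊢
  grind

theorem rowOf_eq_rowOf_iff (x y : Fin (r + 1)) : t.rowOf x = t.rowOf y ↔
    x = y ∨ x = t.cornerLabel hr ∧ y = t.armLabel hr ∨
      x = t.armLabel hr ∧ y = t.cornerLabel hr := by
  obtain ⟨⟨⟨i, j⟩, hc⟩, rfl⟩ := t.surjective x
  obtain ⟨⟨⟨i', j'⟩, hc'⟩, rfl⟩ := t.surjective y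
  have h := (mem_twoOnesShape hr _).1 hc
  have h' := (mem_twoOnesShape hr _).1 hc'
  simp only [rowOf, armLabel, cornerLabel, symm_apply_apply, EmbeddingLike.apply_eq_iff_eq,
    Subtype.mk.injEq, Prod.mk.injEq] at h h' ⊢
  grind

theorem colGroup_eq_stabilizer :
    t.colGroup = MulAction.stabilizer (Perm (Fin (r + 1))) (t.armLabel hr) := by
  ext q
  rw [MulAction.mem_stabilizer_iff, Perm.smul_def]
  change (∀ k, t.colOf (q k) = t.colOf k) ↔ _
  simp only [colOf_eq hr]
  constructor
  · intro h
    simpa using h (t.armLabel hr)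
  · intro h k
    congr 1
    rw [eq_iff_iff]
    conv_lhs => rw [← h]
    exact q.injective.eq_iff

theorem mem_rowGroup_iff (p : Perm (Fin (r + 1))) :
    p ∈ t.rowGroup ↔ p = 1 ∨ p = swap (t.cornerLabel hr) (t.armLabel hr) := by
  have hne := t.cornerLabel_ne_armLabel hr
  change (∀ k, t.rowOf (p k) = t.rowOf k) ↔ _
  simp only [rowOf_eq_rowOf_iff hr]
  generalize t.cornerLabel hr = a at hne ⊢
  generalize t.armLabel hr = b at hne ⊢
  constructor
  · intro h
    have hinj := p.injective
    by_cases ha : p a = a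
    · left
      ext x
      rw [Perm.one_apply]
      grind [h x, hinj.eq_iff]
    · right
      ext x
      have := h a
      have := h b
      have := @hinj a b
      rw [swap_apply_def]
      grind [h x, hinj.eq_iff]
  · rintro (rfl | rfl) k
    · simp
    · rw [swap_apply_def]
      grind

variable {K : Type*} [Field K] [CharZero K]

theorem youngSymmetrizer_eq_smul_hookIdem : ∃ c : K, c ≠ 0 ∧
    t.youngSymmetrizer K = c • hookIdem K (t.armLabel hr) (t.cornerLabel hr) := by
  classical
  have hne := t.cornerLabel_ne_armLabel hr
  set k := t.armLabel hr with hk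
  set a := t.cornerLabel hr with ha
  have hS : (Nat.card (MulAction.stabilizer (Perm (Fin (r + 1))) k) : K) ≠ 0 :=
    Nat.cast_ne_zero.2 Nat.card_pos.ne'
  have hn := card_sub_one_ne_zero_of_ne (K := K) hne
  have hn' := card_ne_zero_of_point (K := K) k
  refine ⟨Nat.card (MulAction.stabilizer (Perm (Fin (r + 1))) k) *
    (((Fintype.card (Fin (r + 1)) : K) - 1) / Fintype.card (Fin (r + 1)))⁻¹,
    mul_ne_zero hS (inv_ne_zero (div_ne_zero hn hn')), ?_⟩
  have hrow : (Finset.univ.filter (· ∈ t.rowGroup)) = {1, swap a k} := by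
    ext p
    simp [t.mem_rowGroup_iff hr, ha, hk]
  have hτ : (1 : Perm (Fin (r + 1))) ≠ swap a k := fun h => hne (swap_eq_one_iff.1 h.symm)
  have hsum (p : Perm (Fin (r + 1))) :
      ∑ q : Perm (Fin (r + 1)) with q ∈ t.colGroup,
        ((sign q : ℤ) : K) • MonoidAlgebra.of K (Perm (Fin (r + 1))) (p * q) =
      (Nat.card (MulAction.stabilizer (Perm (Fin (r + 1))) k) : K) •
        (MonoidAlgebra.of K _ p * altIdem K (MulAction.stabilizer (Perm (Fin (r + 1))) k)) := by
    rw [altIdem, mul_smul_comm, smul_inv_smul₀ hS, Finset.mul_sum]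
    refine Finset.sum_congr ?_ fun q _ => ?_
    · ext q; simp [t.colGroup_eq_stabilizer hr, hk]
    · rw [mul_smul_comm, map_mul]
  rw [hookIdem, mul_smul, inv_smul_smul₀ (div_ne_zero hn hn'), youngSymmetrizer]
  trans ∑ p ∈ {1, swap a k}, (Nat.card (MulAction.stabilizer (Perm (Fin (r + 1))) k) : K) •
        (MonoidAlgebra.of K _ p * altIdem K (MulAction.stabilizer (Perm (Fin (r + 1))) k))
  · refine Finset.sum_congr (by rw [← hrow]) fun p _ => ?_
    rw [← hsum]
  · rw [Finset.sum_pair hτ, ← smul_add, ← add_mul, map_one]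

theorem isYoungIdempotent_iff (e : MonoidAlgebra K (Perm (Fin (r + 1)))) :
    t.IsYoungIdempotent K e ↔ e = hookIdem K (t.armLabel hr) (t.cornerLabel hr) := by
  obtain ⟨c, hc, hy⟩ := t.youngSymmetrizer_eq_smul_hookIdem (K := K) hr
  have hne := t.cornerLabel_ne_armLabel hr
  have hg := isIdempotentElem_hookIdem (K := K) hne
  rw [IsYoungIdempotent, hy]
  constructor
  · rintro ⟨he, m, hm, rfl⟩
    -- a nonzero multiple of a nonzero idempotent is idempotent only if the factor is `1`
    rw [smul_smul] at he ⊢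
    rw [IsIdempotentElem, smul_mul_smul_comm, hg.eq] at he
    have := smul_left_injective K (hookIdem_ne_zero (K := K) hne) he
    rw [mul_eq_left₀ (mul_ne_zero hm hc)] at this
    rw [this, one_smul]
  · rintro rfl
    exact ⟨hg, c⁻¹, inv_ne_zero hc, by rw [inv_smul_smul₀ hc]⟩

theorem span_youngSymmetrizer : Ideal.span {t.youngSymmetrizer K} =
    Ideal.span {hookIdem K (t.armLabel hr) (t.cornerLabel hr)} := by
  obtain ⟨c, hc, hy⟩ := t.youngSymmetrizer_eq_smul_hookIdem (K := K) hr
  rw [hy]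
  apply le_antisymm <;> rw [Ideal.span_singleton_le_iff_mem, Ideal.mem_span_singleton']
  · exact ⟨algebraMap K _ c, by rw [Algebra.smul_def]⟩
  · exact ⟨algebraMap K _ c⁻¹, by rw [← Algebra.smul_def, inv_smul_smul₀ hc]⟩

end

/-! ### Standard tableaux -/

section

variable {r : ℕ} {t : YoungTableau (twoOnesShape r) (r + 1)}

/-- In a hook, every box lies in the row or in the column of the corner, so the corner carries the
least label. -/
theorem IsStandard.cornerLabel_eq_zero (hr : 1 ≤ r) (ht : t.IsStandard) :
    t.cornerLabel hr = 0 := by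
  obtain ⟨⟨⟨i, j⟩, hc⟩, h0⟩ := t.surjective 0
  have h := (mem_twoOnesShape hr _).1 hc
  rw [cornerLabel]
  simp only [Prod.mk.injEq] at h
  rcases h with ⟨rfl, rfl⟩ | ⟨-, rfl⟩
  · exact absurd (h0 ▸ ht.1 ⟨(0, 0), twoOnesShape_corner_mem hr⟩ ⟨(0, 1), hc⟩ rfl zero_lt_one)
      (Fin.not_lt_zero _)
  · rcases Nat.eq_zero_or_pos i with rfl | hi
    · exact h0
    · exact absurd (h0 ▸ ht.2 ⟨(0, 0), twoOnesShape_corner_mem hr⟩ ⟨(i, 0), hc⟩ rfl hi)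
        (Fin.not_lt_zero _)

theorem topTableau_apply_leg (hr : 2 ≤ r) (i : ℕ) (hc) :
    ((topTableau r hr ⟨(i, 0), hc⟩ : Fin (r + 1)) : ℕ) = i := rfl

theorem topTableau_apply_arm (hr : 2 ≤ r) (hc) :
    topTableau r hr ⟨(0, 1), hc⟩ = Fin.last r := rfl

theorem isStandard_topTableau (hr : 2 ≤ r) : (topTableau r hr).IsStandard := by
  constructor
  · rintro ⟨⟨i, j⟩, hc⟩ ⟨⟨i', j'⟩, hc'⟩ h1 h2
    have h := (mem_twoOnesShape (by omega) _).1 hc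
    have h' := (mem_twoOnesShape (by omega) _).1 hc'
    simp only [Prod.mk.injEq] at h h' h1 h2
    obtain rfl : j = 0 := by omega
    obtain rfl : j' = 1 := by omega
    obtain rfl : i' = 0 := by omega
    rw [topTableau_apply_arm, Fin.lt_def, topTableau_apply_leg]
    simp; omega
  · rintro ⟨⟨i, j⟩, hc⟩ ⟨⟨i', j'⟩, hc'⟩ h1 h2
    have h := (mem_twoOnesShape (by omega) _).1 hc
    have h' := (mem_twoOnesShape (by omega) _).1 hc'
    simp only [Prod.mk.injEq] at h h' h1 h2
    obtain rfl : j = 0 := by omega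
    obtain rfl : j' = 0 := by omega
    rwa [Fin.lt_def, topTableau_apply_leg, topTableau_apply_leg]

/-- If the arm carries the greatest label, then the column is filled increasingly with the
remaining `r` labels, which leaves one possibility. -/
theorem IsStandard.eq_topTableau_of_armLabel (hr : 2 ≤ r) (ht : t.IsStandard)
    (h : t.armLabel (by omega) = Fin.last r) : t = topTableau r hr := by
  have hmem (i : Fin r) : ((i : ℕ), 0) ∈ (twoOnesShape r).cells :=
    (mem_twoOnesShape (by omega) _).2 (Or.inr ⟨i.2, rfl⟩)
  have hlt (i : Fin r) : (t ⟨(i, 0), hmem i⟩ : ℕ) < r := by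
    refine lt_of_le_of_ne (Nat.lt_succ_iff.1 (Fin.is_lt _)) fun hi => ?_
    have : t ⟨(i, 0), hmem i⟩ = t.armLabel (by omega) := h ▸ Fin.ext hi
    simp [armLabel] at this
  let f : Fin r → Fin r := fun i => ⟨t ⟨(i, 0), hmem i⟩, hlt i⟩
  have hf : StrictMono f := fun i j hij => ht.2 _ _ rfl hij
  have hid : f = id := by
    refine (hf.range_inj strictMono_id).1 ?_
    rw [(Finite.surjective_of_injective hf.injective).range_eq, Set.range_id]
  ext ⟨⟨i, j⟩, hc⟩
  have hcell := (mem_twoOnesShape (by omega) _).1 hc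
  simp only [Prod.mk.injEq] at hcell
  rcases hcell with ⟨rfl, rfl⟩ | ⟨hi, rfl⟩
  · rw [topTableau_apply_arm]
    exact congrArg Fin.val h
  · rw [topTableau_apply_leg]
    exact congrArg Fin.val (congrFun hid ⟨i, hi⟩)

theorem IsStandard.lexLT_topTableau (hr : 2 ≤ r) (ht : t.IsStandard) (hne : t ≠ topTableau r hr) :
    t.LexLT (topTableau r hr) := by
  refine ⟨⟨(0, 1), twoOnesShape_arm_mem (by omega)⟩, ?_, ?_⟩
  · rw [topTableau_apply_arm]
    exact lt_of_le_of_ne (Fin.le_last _) fun h => hne (ht.eq_topTableau_of_armLabel hr h)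
  · rintro ⟨⟨i, j⟩, hc⟩ h
    obtain ⟨rfl, rfl⟩ : i = 0 ∧ j = 0 := by simpa using h
    exact (ht.cornerLabel_eq_zero (by omega)).trans
      ((isStandard_topTableau hr).cornerLabel_eq_zero (by omega)).symm

end

end YoungTableau

/-! ### The left ideal of the alternating idempotent of a stabilizer -/

open Equiv Equiv.Perm

section

variable {K : Type*} [Field K] {r : ℕ}

theorem idemFA_eq_altIdem : idemFA K r = altIdem K (⊤ : Subgroup (Perm (Fin (r + 1)))) := by
  rw [idemFA, altIdem, one_div, Subgroup.card_top, Nat.card_eq_fintype_card, Fintype.card_perm,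
    Fintype.card_fin]
  congr 2
  ext; simp

theorem idemEA_eq_altIdem :
    idemEA K r = altIdem K (MulAction.stabilizer (Perm (Fin (r + 1))) (Fin.last r)) := by
  have h := card_stabilizer_mul_card (Fin.last r)
  rw [Fintype.card_fin, Nat.factorial_succ] at h
  rw [idemEA, altIdem, one_div, Nat.eq_of_mul_eq_mul_left (Nat.succ_pos r) h]
  congr 2
  ext; simp [MulAction.mem_stabilizer_iff]

/-- A transposition that fixes the last point acts on `h_a` from the right by `-1`, which cancels
against the identity in the row symmetrizer. -/
theorem idemHA_mul_hookIdem_of_ne_last {k a : Fin (r + 1)} (hak : a ≠ k) (hk : k ≠ Fin.last r)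
    (ha : a ≠ Fin.last r) : idemHA K r * hookIdem K k a = 0 := by
  have hmem : swap a k ∈ MulAction.stabilizer (Perm (Fin (r + 1))) (Fin.last r) := by
    rw [MulAction.mem_stabilizer_iff, Perm.smul_def, swap_apply_of_ne_of_ne ha.symm hk.symm]
  rw [hookIdem, mul_smul_comm, ← mul_assoc, mul_add, mul_one, idemHA, sub_mul, idemEA_eq_altIdem,
    idemFA_eq_altIdem, altIdem_mul_of hmem, altIdem_mul_of (Subgroup.mem_top _), sign_swap hak]
  simp

variable [CharZero K]

theorem isIdempotentElem_idemHA : IsIdempotentElem (idemHA K r) := by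
  rw [IsIdempotentElem, idemHA, idemEA_eq_altIdem, idemFA_eq_altIdem, mul_sub, sub_mul, sub_mul,
    altIdem_mul_altIdem_of_le le_rfl, altIdem_mul_altIdem_of_le le_rfl,
    altIdem_mul_altIdem_of_le le_top, altIdem_mul_altIdem_of_ge le_top, sub_self, sub_zero]

theorem idemHA_mul_hookIdem_last {a : Fin (r + 1)} (ha : a ≠ Fin.last r) :
    idemHA K r * hookIdem K (Fin.last r) a = idemHA K r := by
  rw [idemHA, sub_mul, idemEA_eq_altIdem, idemFA_eq_altIdem, altIdem_stabilizer_mul_hookIdem ha,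
    altIdem_top_mul_hookIdem ha, sub_zero]

theorem hookIdem_last_mul_idemHA {a : Fin (r + 1)} (ha : a ≠ Fin.last r) :
    hookIdem K (Fin.last r) a * idemHA K r = hookIdem K (Fin.last r) a := by
  rw [idemHA, mul_sub, idemEA_eq_altIdem, idemFA_eq_altIdem, hookIdem_mul_altIdem_top ha,
    hookIdem_mul_altIdem_stabilizer, sub_zero]

theorem span_hookIdem_last {a : Fin (r + 1)} (ha : a ≠ Fin.last r) :
    Ideal.span {hookIdem K (Fin.last r) a} = Ideal.span {idemHA K r} := by
  apply le_antisymm <;> rw [Ideal.span_singleton_le_iff_mem, Ideal.mem_span_singleton']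
  · exact ⟨_, hookIdem_last_mul_idemHA ha⟩
  · exact ⟨_, idemHA_mul_hookIdem_last ha⟩

/-- A left ideal isomorphic to one generated by a Young symmetrizer of shape `(2, 1^{r-1})` is
annihilated by `f_a` from the right, since there are no nonzero homomorphisms into the sign
representation. -/
theorem mul_idemFA_eq_zero_of_linearEquiv (hr : 1 ≤ r)
    {N : Ideal (MonoidAlgebra K (Perm (Fin (r + 1))))} (t : YoungTableau (twoOnesShape r) (r + 1))
    (φ : N ≃ₗ[MonoidAlgebra K (Perm (Fin (r + 1)))] Ideal.span {t.youngSymmetrizer K})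
    {x : MonoidAlgebra K (Perm (Fin (r + 1)))} (hx : x ∈ N) : x * idemFA K r = 0 := by
  have hne := t.cornerLabel_ne_armLabel hr
  set g := hookIdem K (t.armLabel hr) (t.cornerLabel hr) with hg
  have hspan : Ideal.span {t.youngSymmetrizer K} = Ideal.span {g} :=
    t.span_youngSymmetrizer hr
  have hmem : g ∈ Ideal.span {t.youngSymmetrizer K} := hspan ▸ Ideal.mem_span_singleton_self g
  have hφ : (φ ⟨x, hx⟩ : MonoidAlgebra K (Perm (Fin (r + 1)))) ∈ Ideal.span {g} :=
    hspan.le (φ ⟨x, hx⟩).2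
  obtain ⟨b, hb⟩ := Ideal.mem_span_singleton'.1 hφ
  -- the preimage `w` of the idempotent generator `g` satisfies `w = g w`, and `x = b w`
  set w := φ.symm ⟨g, hmem⟩ with hw
  have hgw : g • w = w := by
    rw [hw, ← map_smul]
    congr 1
    exact Subtype.ext (isIdempotentElem_hookIdem hne).eq
  have hxw : (⟨x, hx⟩ : N) = b • w := by
    rw [hw, ← map_smul, LinearEquiv.eq_symm_apply]
    exact Subtype.ext hb.symm
  have hx' : x = b * (g * w) := by
    have := congrArg Subtype.val hxw
    rw [← hgw] at this
    exact this
  rw [hx', mul_assoc, mul_assoc, idemFA_eq_altIdem, hookIdem_mul_mul_altIdem_top hne, mul_zero]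

theorem span_idemHA_eq_youngPart (hr : 2 ≤ r) :
    Ideal.span {idemHA K r} = youngPart K (twoOnesShape r) (Ideal.span {idemEA K r}) := by
  have hlast : (0 : Fin (r + 1)) ≠ Fin.last r := by
    rw [Ne, Fin.ext_iff]; simp; omega
  apply le_antisymm
  · refine le_sSup ⟨?_, topTableau r hr, ⟨LinearEquiv.ofEq _ _ ?_⟩⟩
    · rw [Ideal.span_singleton_le_iff_mem, Ideal.mem_span_singleton']
      refine ⟨idemHA K r, ?_⟩
      rw [idemHA, sub_mul, idemEA_eq_altIdem, idemFA_eq_altIdem, altIdem_mul_altIdem_of_le le_rfl,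
        altIdem_mul_altIdem_of_ge le_top]
    · rw [YoungTableau.span_youngSymmetrizer (by omega)]
      exact (span_hookIdem_last hlast).symm
  · refine sSup_le ?_
    rintro N ⟨hN, t, ⟨φ⟩⟩ x hx
    obtain ⟨b, rfl⟩ := Ideal.mem_span_singleton'.1 (hN hx)
    have h0 := mul_idemFA_eq_zero_of_linearEquiv (by omega) t φ hx
    rw [Ideal.mem_span_singleton']
    -- `b e_a = b e_a e_a = b e_a h_a`, because `b e_a f_a = 0`
    refine ⟨b * idemEA K r, ?_⟩
    rw [idemHA, mul_sub, h0, sub_zero, mul_assoc, idemEA_eq_altIdem,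
      altIdem_mul_altIdem_of_le le_rfl]

end

theorem mainTheorem4 (K : Type*) [RCLike K] (r : ℕ) (hr : 2 ≤ r) :
    -- the tableau is the lexicographically greatest standard tableau of its shape
    ((topTableau r hr).IsStandard ∧
      ∀ t' : YoungTableau (twoOnesShape r) (r + 1), t'.IsStandard → t' ≠ topTableau r hr →
        YoungTableau.LexLT t' (topTableau r hr)) ∧
    -- the Young symmetrizer idempotents of the standard tableaux exist and are unique
    (∀ t : YoungTableau (twoOnesShape r) (r + 1), t.IsStandard →
      ∃! e : MonoidAlgebra K (Equiv.Perm (Fin (r + 1))), t.IsYoungIdempotent K e) ∧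
    IsIdempotentElem (idemHA K r) ∧
    -- the idempotent of the greatest tableau reproduces `h_a`, and both generate the same left ideal,
    -- which is the part of type `[2, 1^{r-1}]` of the left ideal generated by `e_a`
    (∀ e : MonoidAlgebra K (Equiv.Perm (Fin (r + 1))),
      (topTableau r hr).IsYoungIdempotent K e →
        idemHA K r * e = idemHA K r ∧
        Ideal.span {e} = Ideal.span {idemHA K r} ∧
        Ideal.span {e} = youngPart K (twoOnesShape r) (Ideal.span {idemEA K r})) ∧
    -- the idempotents of all other standard tableaux annihilate `h_a`
    (∀ t' : YoungTableau (twoOnesShape r) (r + 1), t'.IsStandard → t' ≠ topTableau r hr →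
      ∀ e' : MonoidAlgebra K (Equiv.Perm (Fin (r + 1))),
        t'.IsYoungIdempotent K e' → idemHA K r * e' = 0) := by
  have hr1 : 1 ≤ r := by omega
  have hcorner {t : YoungTableau (twoOnesShape r) (r + 1)} (ht : t.IsStandard) :
      t.cornerLabel hr1 ≠ Fin.last r := by
    rw [ht.cornerLabel_eq_zero hr1, Ne, Fin.ext_iff]; simp; omega
  refine ⟨⟨YoungTableau.isStandard_topTableau hr, fun t' ht' hne => ht'.lexLT_topTableau hr hne⟩,
    fun t _ => ?_, isIdempotentElem_idemHA, fun e he => ?_, fun t' ht' hne e' he' => ?_⟩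
  · simp only [t.isYoungIdempotent_iff hr1]
    exact existsUnique_eq
  · have htop := hcorner (YoungTableau.isStandard_topTableau hr)
    rw [YoungTableau.isYoungIdempotent_iff hr1] at he
    rw [← span_idemHA_eq_youngPart hr, he]
    exact ⟨idemHA_mul_hookIdem_last htop, span_hookIdem_last htop, span_hookIdem_last htop⟩
  · rw [YoungTableau.isYoungIdempotent_iff hr1] at he'
    rw [he']
    exact idemHA_mul_hookIdem_of_ne_last (t'.cornerLabel_ne_armLabel hr1)
      (fun h => hne (ht'.eq_topTableau_of_armLabel hr h)) (hcorner ht')
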